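/- Let $\mathcal G$ be a connected, undirected (simple) graph on $n$ nodes, with degree matrix $D$, adjacency matrix $A$ and Laplacian $L=D-A$. Let $m>0$, let $K=\mathrm{diag}(k_1,\dots,k_n)$ with all $k_i>0$, and put $S=(I_n+D)^{-1}$ and $Q=I_n-S(I_n+A)$ (so that $Q=SL$). Consider the multiagent system $\dot x=u+w$ with an unknown constant disturbance $w\in\mathbb R^n$ and the controller $$u=-Lx-\hat w,\qquad \dot{\hat w}=KQ(x-\hat x),\qquad \dot{\hat x}=-L\hat x+m(x-\hat x),\qquad t\ge 0.$$ The errors $\tilde x=x-\hat x$ and $\tilde w=\hat w-w$, collected in $e=[\tilde x^{\mathrm T},\tilde w^{\mathrm T}]^{\mathrm T}$, satisfy the error system $$\dot e(t)=\tilde A_0\,e(t),\quad t\ge 0,\qquad \tilde A_0=\begin{bmatrix}-L-mI_n&-I_n\\ KQ&0\end{bmatrix}.$$ For every $e_0\in\mathbb R^{2n}$ the error system has a solution $e$ on $[0,\infty)$ with $e(0)=e_0$, and every solution $e$ of the error system on $[0,\infty)$ has the following two properties. 1. It is Lyapunov stable: for every $\eta>0$ there is $\delta>0$ such that every solution $z$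 of the error system with $\|z(0)-e(0)\|<\delta$ satisfies $\|z(t)-e(t)\|<\eta$ for all $t\ge 0$. 2. There is a constant $\epsilon\in\mathbb R$ (depending on $e$) such that $e(t)\to\epsilon\,[\mathbf 1_n^{\mathrm T},\,-m\mathbf 1_n^{\mathrm T}]^{\mathrm T}$ as $t\to\infty$. -/

import Mathlib

open Filter Topology

noncomputable section

/-- `e` solves the autonomous system `e' = f e` on `[0, ∞)` (one-sided derivative at `0`). -/
def IsSolution {E : Type*} [NormedAddCommGroup E] [NormedSpace ℝ E] (f : E → E) (e : ℝ → E) :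
    Prop :=
  ∀ t : ℝ, 0 ≤ t → HasDerivWithinAt e (f (e t)) (Set.Ici 0) t

/-- Lyapunov stability of the solution `e` of `e' = f e`: solutions starting close enough to `e 0`
stay close to `e` for all `t ≥ 0`. In finite dimension this does not depend on the norm. -/
def IsLyapunovStable {E : Type*} [NormedAddCommGroup E] [NormedSpace ℝ E] (f : E → E) (e : ℝ → E) :
    Prop :=
  ∀ η : ℝ, 0 < η → ∃ δ : ℝ, 0 < δ ∧ ∀ z : ℝ → E, IsSolution f z →
    ‖z 0 - e 0‖ < δ → ∀ t : ℝ, 0 ≤ t → ‖z t - e t‖ < η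

variable {V : Type*} [Fintype V] [DecidableEq V] (G : SimpleGraph V) [DecidableRel G.Adj]

/-- `S = diag (1 / (Nᵢ + 1))`, where `Nᵢ` is the number of neighbors of `i`;
thus `S = (I + D)⁻¹`. -/
def scalingMatrix : Matrix V V ℝ :=
  Matrix.diagonal fun i => ((G.degree i : ℝ) + 1)⁻¹

/-- `Q = I - S (I + A)`, where `A` is the adjacency matrix. -/
def localProjection : Matrix V V ℝ :=
  1 - scalingMatrix G * (1 + G.adjMatrix ℝ)

/-- The block matrix `[[-L - m I, -I], [K Q, 0]]` with `K = diag k`. -/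
def errorMatrix (m : ℝ) (k : V → ℝ) : Matrix (V ⊕ V) (V ⊕ V) ℝ :=
  Matrix.fromBlocks (-G.lapMatrix ℝ - m • (1 : Matrix V V ℝ)) (-1)
    (Matrix.diagonal k * localProjection G) 0

/-- The error system `e' = [[-L - m I, -I], [K Q, 0]] e`, as a vector field. -/
def errorField (m : ℝ) (k : V → ℝ) (e : V ⊕ V → ℝ) : V ⊕ V → ℝ :=
  (errorMatrix G m k).mulVec e

/-- The controlled multiagent system on `[0, ∞)`: agents `x' = u + w` with constant disturbance `w`
and control `u = -L x - ŵ`, predicted state `x̂' = -L x̂ + m (x - x̂)`, and disturbance estimate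
`ŵ' = K Q (x - x̂)`. -/
structure IsClosedLoop (m : ℝ) (k w : V → ℝ) (x xhat what : ℝ → V → ℝ) : Prop where
  state : ∀ t : ℝ, 0 ≤ t →
    HasDerivWithinAt x ((-(G.lapMatrix ℝ).mulVec (x t) - what t) + w) (Set.Ici 0) t
  predictor : ∀ t : ℝ, 0 ≤ t →
    HasDerivWithinAt xhat (-(G.lapMatrix ℝ).mulVec (xhat t) + m • (x t - xhat t)) (Set.Ici 0) t
  estimator : ∀ t : ℝ, 0 ≤ t →
    HasDerivWithinAt what
      ((Matrix.diagonal k * localProjection G).mulVec (x t - xhat t)) (Set.Ici 0) t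

end

/-! Dividing the `w̃` equation by the gains of `K S` and summing gives `1ᵀ L x̃ = 0`, so
`limitCoefficient` is conserved. It equals 1 on the equilibrium `[1; -m 1]`, so subtracting the
multiple of that equilibrium fixed by `e 0` leaves a solution in its kernel. It suffices to prove
exponential decay there.

The natural `energy` only dissipates `L x̃`, so it is corrected to `energy + γ (crossTerm + c
meanTerm)`. Where `L x̃ = 0`, `crossTerm` dissipates `2 w̃ᵀ L w̃`. Where that vanishes too, `w̃` is
constant, hence zero in the kernel, and `meanTerm` dissipates `2 m (1ᵀ x̃)²`. Two uses of Finsler's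
lemma (`eventually_add_mul_pos`) choose `c` and then `γ`; the result is `exists_strict_lyapunov`. -/

noncomputable section

/-! ### Quadratic-type functions, Finsler's lemma and exponential decay. -/

/-- A continuous function that is homogeneous of degree two. -/
structure IsHomogTwo {E : Type*} [NormedAddCommGroup E] [NormedSpace ℝ E] (f : E → ℝ) : Prop where
  continuous : Continuous f
  smul : ∀ (a : ℝ) (x : E), f (a • x) = a ^ 2 * f x

namespace IsHomogTwo

variable {E : Type*} [NormedAddCommGroup E] [NormedSpace ℝ E] {f g : E → ℝ}

theorem add (hf : IsHomogTwo f) (hg : IsHomogTwo g) : IsHomogTwo fun x => f x + g x :=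
  ⟨hf.continuous.add hg.continuous, fun a x => by rw [hf.smul, hg.smul]; ring⟩

theorem const_mul (hf : IsHomogTwo f) (c : ℝ) : IsHomogTwo fun x => c * f x :=
  ⟨hf.continuous.const_mul c, fun a x => by rw [hf.smul]; ring⟩

theorem neg (hf : IsHomogTwo f) : IsHomogTwo fun x => -f x :=
  ⟨hf.continuous.neg, fun a x => by rw [hf.smul]; ring⟩

theorem norm_sq : IsHomogTwo fun x : E => ‖x‖ ^ 2 :=
  ⟨by fun_prop, fun a x => by rw [norm_smul, mul_pow, Real.norm_eq_abs, sq_abs]⟩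

/-- Finsler's lemma: if `f ≥ 0` and `g > 0` on the nonzero zeros of `f`, then `f + γ g` is positive
definite for small `γ > 0`. -/
theorem eventually_add_mul_pos [FiniteDimensional ℝ E] (hf : IsHomogTwo f) (hg : IsHomogTwo g)
    (U : Submodule ℝ E) (hf0 : ∀ x ∈ U, 0 ≤ f x) (hg0 : ∀ x ∈ U, x ≠ 0 → f x = 0 → 0 < g x) :
    ∀ᶠ γ in 𝓝[>] (0 : ℝ), ∀ x ∈ U, x ≠ 0 → 0 < f x + γ * g x := by
  have : ProperSpace E := FiniteDimensional.proper ℝ E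
  have hK : IsCompact (Metric.sphere (0 : E) 1 ∩ U) :=
    (isCompact_sphere 0 1).inter_right U.closed_of_finiteDimensional
  have hK' : IsCompact ((Metric.sphere (0 : E) 1 ∩ U) ∩ {x | g x ≤ 0}) :=
    hK.inter_right (isClosed_le hg.continuous continuous_const)
  have hne : ∀ x ∈ Metric.sphere (0 : E) 1, x ≠ 0 := by
    rintro x hx rfl
    simp at hx
  -- On the compact part of the unit sphere where `g ≤ 0`, `f` cannot vanish, so it has a positive
  -- lower bound `a`. Taking `γ * b < a`, with `b` a bound for `|g|`, handles that part; elsewhere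
  -- `g` itself helps.
  obtain ⟨a, ha, hfa⟩ := hK'.exists_forall_le' (f := f) (a := 0) hf.continuous.continuousOn
    (fun x hx => (hf0 x hx.1.2).lt_of_ne fun h =>
      absurd (hg0 x hx.1.2 (hne x hx.1.1) h.symm) (not_lt.2 hx.2))
  obtain ⟨b, hb⟩ := hK.exists_bound_of_continuousOn hg.continuous.continuousOn
  have hlim : Tendsto (fun γ : ℝ => γ * b) (𝓝[>] 0) (𝓝 0) := by
    have : Tendsto (fun γ : ℝ => γ * b) (𝓝 0) (𝓝 (0 * b)) := tendsto_id.mul_const b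
    rw [zero_mul] at this
    exact this.mono_left nhdsWithin_le_nhds
  filter_upwards [hlim.eventually_lt_const ha, self_mem_nhdsWithin] with γ hγ hγ0 x hx hx0
  have hγ0 : 0 < γ := hγ0
  have key : ∀ y ∈ Metric.sphere (0 : E) 1 ∩ U, 0 < f y + γ * g y := by
    intro y hy
    by_cases h : g y ≤ 0
    · have h1 := hfa y ⟨hy, h⟩
      have h2 := (abs_le.1 (hb y hy)).1
      nlinarith
    · have h1 := hf0 y hy.2
      have h2 := mul_pos hγ0 (not_le.1 h)
      linarith
  have hx' : 0 < ‖x‖ := norm_pos_iff.2 hx0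
  have h := key (‖x‖⁻¹ • x) ⟨by simp [norm_smul, hx'.ne'], U.smul_mem _ hx⟩
  rw [hf.smul, hg.smul] at h
  have h2 : 0 < (‖x‖⁻¹) ^ 2 * (f x + γ * g x) := by linarith
  exact (pos_iff_pos_of_mul_pos h2).1 (by positivity)

theorem exists_add_mul_pos [FiniteDimensional ℝ E] (hf : IsHomogTwo f) (hg : IsHomogTwo g)
    (U : Submodule ℝ E) (hf0 : ∀ x ∈ U, 0 ≤ f x) (hg0 : ∀ x ∈ U, x ≠ 0 → f x = 0 → 0 < g x) :
    ∃ γ > 0, ∀ x ∈ U, x ≠ 0 → 0 < f x + γ * g x := by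
  obtain ⟨γ, h1, h2⟩ :=
    ((hf.eventually_add_mul_pos hg U hf0 hg0).and self_mem_nhdsWithin).exists
  exact ⟨γ, h2, h1⟩

theorem map_zero (hf : IsHomogTwo f) : f 0 = 0 := by
  simpa using hf.smul 0 0

/-- Finsler's lemma for `f` and `-g`: `f` has no nonzero zeros on `U`, so the condition on `-g` is
vacuous. -/
theorem exists_mul_le [FiniteDimensional ℝ E] (hf : IsHomogTwo f) (hg : IsHomogTwo g)
    (U : Submodule ℝ E) (hpos : ∀ x ∈ U, x ≠ 0 → 0 < f x) :
    ∃ c > 0, ∀ x ∈ U, c * g x ≤ f x := by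
  have hnn : ∀ x ∈ U, 0 ≤ f x := fun x hx => by
    rcases eq_or_ne x 0 with rfl | h
    · rw [hf.map_zero]
    · exact (hpos x hx h).le
  obtain ⟨c, hc, h⟩ := hf.exists_add_mul_pos hg.neg U hnn
    (fun x hx h0 h1 => absurd h1 (hpos x hx h0).ne')
  refine ⟨c, hc, fun x hx => ?_⟩
  rcases eq_or_ne x 0 with rfl | h0
  · simp [hf.map_zero, hg.map_zero]
  · have := h x hx h0
    linarith

/-- A quadratic strict Lyapunov function `W` with derivative `-D` forces exponential decay. -/
theorem exists_exp_decay [FiniteDimensional ℝ E] {W D : E → ℝ} (hW : IsHomogTwo W)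
    (hD : IsHomogTwo D) (U : Submodule ℝ E) (hWpos : ∀ x ∈ U, x ≠ 0 → 0 < W x)
    (hDpos : ∀ x ∈ U, x ≠ 0 → 0 < D x) :
    ∃ C > 0, ∃ r > 0, ∀ y : ℝ → E, (∀ t, 0 ≤ t → y t ∈ U) →
      (∀ t, 0 ≤ t → HasDerivWithinAt (fun t => W (y t)) (-D (y t)) (Set.Ici 0) t) →
      ∀ t, 0 ≤ t → ‖y t‖ ^ 2 ≤ C * Real.exp (-r * t) * ‖y 0‖ ^ 2 := by
  obtain ⟨r, hr, hDW⟩ := hD.exists_mul_le hW U hDpos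
  obtain ⟨c, hc, hWn⟩ := hW.exists_mul_le norm_sq U hWpos
  obtain ⟨b, hb, hnW⟩ := norm_sq.exists_mul_le hW U
    (fun x _ hx => by have := norm_pos_iff.2 hx; positivity)
  refine ⟨(b * c)⁻¹, by positivity, r, hr, fun y hyU hy t ht => ?_⟩
  -- Integrating factor: since `r * W ≤ D` on `U`, `exp (r t) W` is nonincreasing.
  have hderiv : ∀ t, 0 ≤ t → HasDerivWithinAt (fun t => Real.exp (r * t) * W (y t))
      (Real.exp (r * t) * (r * W (y t) - D (y t))) (Set.Ici 0) t := by
    intro t ht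
    have h1 : HasDerivWithinAt (fun t => Real.exp (r * t)) (Real.exp (r * t) * (r * 1))
        (Set.Ici 0) t := (((hasDerivAt_id t).const_mul r).exp).hasDerivWithinAt
    exact (h1.mul (hy t ht)).congr_deriv (by ring)
  have hanti : AntitoneOn (fun t => Real.exp (r * t) * W (y t)) (Set.Ici 0) := by
    refine antitoneOn_of_hasDerivWithinAt_nonpos (convex_Ici 0)
      (fun t ht => (hderiv t ht).continuousWithinAt)
      (fun t ht => (hderiv t (interior_subset ht)).mono interior_subset) (fun t ht => ?_)
    have := hDW (y t) (hyU t (interior_subset ht))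
    exact mul_nonpos_of_nonneg_of_nonpos (Real.exp_pos _).le (by linarith)
  have h1 : Real.exp (r * t) * W (y t) ≤ W (y 0) := by
    simpa using hanti (Set.mem_Ici.2 le_rfl) (Set.mem_Ici.2 ht) ht
  have h2 : W (y t) ≤ Real.exp (-r * t) * W (y 0) := by
    have := mul_le_mul_of_nonneg_left h1 (Real.exp_pos (-r * t)).le
    rwa [← mul_assoc, ← Real.exp_add, show -r * t + r * t = 0 by ring, Real.exp_zero,
      one_mul] at this
  have h3 := hWn (y t) (hyU t ht)
  have h4 := hnW (y 0) (hyU 0 le_rfl)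
  have he := Real.exp_pos (-r * t)
  have h5 : b * (c * ‖y t‖ ^ 2) ≤ Real.exp (-r * t) * ‖y 0‖ ^ 2 := by
    calc b * (c * ‖y t‖ ^ 2) ≤ b * (Real.exp (-r * t) * W (y 0)) :=
          mul_le_mul_of_nonneg_left (h3.trans h2) hb.le
      _ = Real.exp (-r * t) * (b * W (y 0)) := by ring
      _ ≤ _ := by gcongr
  rw [mul_assoc, inv_mul_eq_div, le_div_iff₀ (by positivity)]
  linarith

end IsHomogTwo

/-! ### Linear systems with a first integral. -/

section LinearSystem

variable {E : Type*} [NormedAddCommGroup E] [NormedSpace ℝ E]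

theorem IsSolution.sub {f : E →ₗ[ℝ] E} {y z : ℝ → E} (hy : IsSolution f y) (hz : IsSolution f z) :
    IsSolution f (fun t => y t - z t) :=
  fun t ht => ((hy t ht).sub (hz t ht)).congr_deriv (map_sub f _ _).symm

theorem isSolution_const {f : E → E} {v : E} (hv : f v = 0) : IsSolution f (fun _ => v) :=
  fun t _ => by simpa [hv] using hasDerivWithinAt_const t (Set.Ici 0) v

theorem exists_isSolution_linear [FiniteDimensional ℝ E] (f : E →ₗ[ℝ] E) (e₀ : E) :
    ∃ e : ℝ → E, IsSolution f e ∧ e 0 = e₀ := by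
  have : CompleteSpace E := FiniteDimensional.complete ℝ E
  let A : E →L[ℝ] E := LinearMap.toContinuousLinearMap f
  refine ⟨fun t => NormedSpace.exp (t • A) e₀, fun t _ => ?_, by simp⟩
  have h := (hasDerivAt_exp_smul_const' A t).clm_apply (hasDerivAt_const t e₀)
  refine (h.congr_deriv ?_).hasDerivWithinAt
  simp [A]

theorem IsSolution.hasDerivWithinAt_linear [FiniteDimensional ℝ E] {F : Type*}
    [NormedAddCommGroup F] [NormedSpace ℝ F] {f : E → E} {e : ℝ → E} (he : IsSolution f e)
    (l : E →ₗ[ℝ] F) {t : ℝ} (ht : 0 ≤ t) :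
    HasDerivWithinAt (fun t => l (e t)) (l (f (e t))) (Set.Ici 0) t :=
  (LinearMap.toContinuousLinearMap l).hasFDerivAt.comp_hasDerivWithinAt t (he t ht)

theorem IsSolution.linear_eq_of_comp_eq_zero [FiniteDimensional ℝ E] {f : E → E} {e : ℝ → E}
    (he : IsSolution f e) (l : E →ₗ[ℝ] ℝ) (hl : ∀ x, l (f x) = 0) {t : ℝ} (ht : 0 ≤ t) :
    l (e t) = l (e 0) := by
  have hd : ∀ s, 0 ≤ s → HasDerivWithinAt (fun t => l (e t)) 0 (Set.Ici 0) s := fun s hs =>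
    (he.hasDerivWithinAt_linear l hs).congr_deriv (hl _)
  refine (convex_Ici (0 : ℝ)).is_const_of_fderivWithin_eq_zero (𝕜 := ℝ) (f := fun t => l (e t))
    (fun s hs => (hd s hs).differentiableWithinAt) (fun s hs => ?_) ht (Set.mem_Ici.2 le_rfl)
  have h := (hd s hs).hasFDerivWithinAt.fderivWithin (uniqueDiffOn_Ici 0 s hs)
  rw [h]
  ext
  simp

/-- Exponential convergence of every solution to its projection `l (e 0) • v` onto the line of
equilibria, from exponential decay on `ker l`. -/
theorem lyapunovStable_and_tendsto_of_exp_decay [FiniteDimensional ℝ E] (f : E →ₗ[ℝ] E) (v : E)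
    (l : E →ₗ[ℝ] ℝ) (hv : f v = 0) (hlv : l v = 1) (hl : ∀ x, l (f x) = 0) {C r : ℝ}
    (hC : 0 < C) (hr : 0 < r)
    (hdecay : ∀ y : ℝ → E, IsSolution f y → (∀ t, 0 ≤ t → l (y t) = 0) →
      ∀ t, 0 ≤ t → ‖y t‖ ^ 2 ≤ C * Real.exp (-r * t) * ‖y 0‖ ^ 2)
    {e : ℝ → E} (he : IsSolution f e) :
    IsLyapunovStable f e ∧ Tendsto e atTop (𝓝 (l (e 0) • v)) := by
  -- As `l` is conserved and `l v = 1`, subtracting the equilibrium `l (y 0) • v` gives a solution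
  -- inside `ker l`.
  have hmain : ∀ y : ℝ → E, IsSolution f y → ∀ t, 0 ≤ t →
      ‖y t - l (y 0) • v‖ ^ 2 ≤ C * Real.exp (-r * t) * ‖y 0 - l (y 0) • v‖ ^ 2 := by
    intro y hy
    refine hdecay (fun t => y t - l (y 0) • v)
      (hy.sub (isSolution_const (by rw [map_smul, hv, smul_zero]))) (fun t ht => ?_)
    simp [hlv, hy.linear_eq_of_comp_eq_zero l hl ht]
  constructor
  · intro η hη
    -- This function of the initial difference `d` bounds the distance for all later times; its
    -- continuity at 0 supplies `δ`.
    have hcont : Tendsto (fun d : E => √C * ‖d - l d • v‖ + ‖l d • v‖) (𝓝 0) (𝓝 0) := by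
      have hlc : Continuous l := l.continuous_of_finiteDimensional
      have : Continuous (fun d : E => √C * ‖d - l d • v‖ + ‖l d • v‖) := by fun_prop
      simpa using this.tendsto 0
    obtain ⟨δ, hδ, hδη⟩ := Metric.eventually_nhds_iff.1 (hcont.eventually_lt_const hη)
    refine ⟨δ, hδ, fun z hz hz0 t ht => ?_⟩
    have h1 := hmain _ (hz.sub he) t ht
    have h2 := hδη (y := z 0 - e 0) (by simpa using hz0)
    set d := z 0 - e 0
    have h3 : ‖z t - e t - l d • v‖ ≤ √C * ‖d - l d • v‖ := by
      refine abs_le_of_sq_le_sq' ?_ (by positivity) |>.2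
      rw [mul_pow, Real.sq_sqrt hC.le]
      refine h1.trans ?_
      gcongr
      exact mul_le_of_le_one_right hC.le (Real.exp_le_one_iff.2 (by nlinarith))
    calc ‖z t - e t‖ = ‖(z t - e t - l d • v) + l d • v‖ := by rw [sub_add_cancel]
      _ ≤ _ := norm_add_le _ _
      _ < η := by linarith
  · have h1 : Tendsto (fun t => C * Real.exp (-r * t) * ‖e 0 - l (e 0) • v‖ ^ 2) atTop (𝓝 0) := by
      have h : Tendsto (fun t : ℝ => Real.exp (-r * t)) atTop (𝓝 0) :=
        Real.tendsto_exp_atBot.comp (tendsto_id.const_mul_atTop_of_neg (neg_neg_of_pos hr))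
      simpa using (h.const_mul C).mul_const (‖e 0 - l (e 0) • v‖ ^ 2)
    have h2 : Tendsto (fun t => ‖e t - l (e 0) • v‖ ^ 2) atTop (𝓝 0) :=
      squeeze_zero' (Eventually.of_forall fun t => by positivity)
        ((eventually_ge_atTop 0).mono fun t ht => hmain e he t ht) h1
    have h3 := h2.sqrt
    simp only [Real.sqrt_sq (norm_nonneg _), Real.sqrt_zero] at h3
    exact tendsto_iff_norm_sub_tendsto_zero.2 h3

end LinearSystem

/-! ### The graph Laplacian and `Q = S L`. -/

section Laplacian

open Matrix

variable {V : Type*} [Fintype V] [DecidableEq V] (G : SimpleGraph V) [DecidableRel G.Adj]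

theorem SimpleGraph.dotProduct_lapMatrix_mulVec_comm (x y : V → ℝ) :
    x ⬝ᵥ G.lapMatrix ℝ *ᵥ y = (G.lapMatrix ℝ *ᵥ x) ⬝ᵥ y := by
  rw [dotProduct_mulVec, ← mulVec_transpose, (G.isSymm_lapMatrix (R := ℝ)).eq]

theorem SimpleGraph.sum_lapMatrix_mulVec (x : V → ℝ) : ∑ i, (G.lapMatrix ℝ *ᵥ x) i = 0 := by
  have h := G.dotProduct_lapMatrix_mulVec_comm (fun _ => 1) x
  rw [G.lapMatrix_mulVec_const_eq_zero, zero_dotProduct] at h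
  simpa [dotProduct] using h

theorem SimpleGraph.lapMatrix_dotProduct_nonneg (x : V → ℝ) : 0 ≤ x ⬝ᵥ G.lapMatrix ℝ *ᵥ x := by
  simpa using (G.posSemidef_lapMatrix ℝ).dotProduct_mulVec_nonneg x

theorem SimpleGraph.lapMatrix_dotProduct_eq_zero_iff (x : V → ℝ) :
    x ⬝ᵥ G.lapMatrix ℝ *ᵥ x = 0 ↔ G.lapMatrix ℝ *ᵥ x = 0 := by
  simpa using (G.posSemidef_lapMatrix ℝ).dotProduct_mulVec_zero_iff x

variable {G} in
theorem SimpleGraph.Connected.exists_eq_const_of_lapMatrix_mulVec_eq_zero (hG : G.Connected)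
    {x : V → ℝ} (hx : G.lapMatrix ℝ *ᵥ x = 0) : ∃ c : ℝ, x = fun _ => c := by
  obtain ⟨i⟩ := hG.nonempty
  exact ⟨x i, funext fun j =>
    (G.lapMatrix_mulVec_eq_zero_iff_forall_reachable).1 hx j i (hG.preconnected j i)⟩

/-- Since `S (I + D) = I`, `I - S (I + A) = S (D - A) = S L`. -/
theorem localProjection_mulVec_apply (x : V → ℝ) (i : V) :
    (localProjection G *ᵥ x) i = ((G.degree i : ℝ) + 1)⁻¹ * (G.lapMatrix ℝ *ᵥ x) i := by
  have hd : (G.degree i : ℝ) + 1 ≠ 0 := by positivity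
  rw [localProjection, scalingMatrix, SimpleGraph.lapMatrix, sub_mulVec, sub_mulVec,
    ← mulVec_mulVec, add_mulVec, one_mulVec, Pi.sub_apply, Pi.sub_apply, mulVec_diagonal,
    Pi.add_apply, SimpleGraph.degMatrix_mulVec_apply]
  field_simp
  ring

end Laplacian

/-! ### The error system, its first integral and its Lyapunov function. -/

section ErrorSystem

open Matrix

variable {V : Type*} [Fintype V] (G : SimpleGraph V) [DecidableRel G.Adj]

theorem IsHomogTwo.dotProduct_linear {E : Type*} [NormedAddCommGroup E] [NormedSpace ℝ E]
    [FiniteDimensional ℝ E] (a b : E →ₗ[ℝ] V → ℝ) : IsHomogTwo fun e => a e ⬝ᵥ b e := by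
  have ha := a.continuous_of_finiteDimensional
  have hb := b.continuous_of_finiteDimensional
  refine ⟨ha.dotProduct hb, fun c e => ?_⟩
  rw [map_smul, map_smul, smul_dotProduct, dotProduct_smul, smul_smul, smul_eq_mul, sq]

theorem IsHomogTwo.mul_linear {E : Type*} [NormedAddCommGroup E] [NormedSpace ℝ E]
    [FiniteDimensional ℝ E] (a b : E →ₗ[ℝ] ℝ) : IsHomogTwo fun e => a e * b e := by
  have ha := a.continuous_of_finiteDimensional
  have hb := b.continuous_of_finiteDimensional
  refine ⟨ha.mul hb, fun c e => ?_⟩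
  simp only [map_smul, smul_eq_mul]
  ring

/-- The sum of the coordinates. -/
def sumLin : (V → ℝ) →ₗ[ℝ] ℝ := Fintype.linearCombination ℝ (fun _ => 1)

theorem sumLin_apply (x : V → ℝ) : sumLin x = ∑ i, x i := by
  simp [sumLin, Fintype.linearCombination_apply]

theorem IsSolution.hasDerivWithinAt_dotProduct {E : Type*} [NormedAddCommGroup E]
    [NormedSpace ℝ E] [FiniteDimensional ℝ E] {f : E → E} {e : ℝ → E} (he : IsSolution f e)
    (a b : E →ₗ[ℝ] V → ℝ) {t : ℝ} (ht : 0 ≤ t) :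
    HasDerivWithinAt (fun t => a (e t) ⬝ᵥ b (e t))
      (a (f (e t)) ⬝ᵥ b (e t) + a (e t) ⬝ᵥ b (f (e t))) (Set.Ici 0) t := by
  have ha := hasDerivWithinAt_pi.1 (he.hasDerivWithinAt_linear a ht)
  have hb := hasDerivWithinAt_pi.1 (he.hasDerivWithinAt_linear b ht)
  have h := HasDerivWithinAt.fun_sum (u := Finset.univ) fun i _ => (ha i).mul (hb i)
  refine h.congr_deriv ?_
  rw [Finset.sum_add_distrib]
  rfl

/-- The gain `kᵢ / (Nᵢ + 1)` of the disturbance estimator at node `i`. -/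
def estimatorGain (k : V → ℝ) (i : V) : ℝ :=
  k i * ((G.degree i : ℝ) + 1)⁻¹

theorem estimatorGain_pos {k : V → ℝ} (hk : ∀ i, 0 < k i) (i : V) : 0 < estimatorGain G k i :=
  mul_pos (hk i) (by positivity)

/-- The `x̃` component of the error. -/
def stateError : (V ⊕ V → ℝ) →ₗ[ℝ] V → ℝ := LinearMap.funLeft ℝ ℝ Sum.inl

/-- The `w̃` component of the error. -/
def disturbanceError : (V ⊕ V → ℝ) →ₗ[ℝ] V → ℝ := LinearMap.funLeft ℝ ℝ Sum.inr

/-- The coefficient of the limit of the error along `[1; -m 1]`, a first integral. -/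
def limitCoefficient (m : ℝ) (k : V → ℝ) : (V ⊕ V → ℝ) →ₗ[ℝ] ℝ :=
  (-(m * ∑ i, (estimatorGain G k i)⁻¹)⁻¹) •
    (Fintype.linearCombination ℝ (fun i => (estimatorGain G k i)⁻¹) ∘ₗ disturbanceError)

theorem limitCoefficient_apply (m : ℝ) (k : V → ℝ) (e : V ⊕ V → ℝ) :
    limitCoefficient G m k e = -(m * ∑ i, (estimatorGain G k i)⁻¹)⁻¹ *
      ∑ i, disturbanceError e i * (estimatorGain G k i)⁻¹ := by
  simp [limitCoefficient, Fintype.linearCombination_apply]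

variable {G} in
theorem limitCoefficient_pos_den (hG : G.Connected) {m : ℝ} (hm : 0 < m) {k : V → ℝ}
    (hk : ∀ i, 0 < k i) : 0 < m * ∑ i, (estimatorGain G k i)⁻¹ := by
  have := hG.nonempty
  exact mul_pos hm (Finset.sum_pos (fun i _ => inv_pos.2 (estimatorGain_pos G hk i))
    Finset.univ_nonempty)

variable {G} in
theorem limitCoefficient_equilibrium (hG : G.Connected) {m : ℝ} (hm : 0 < m) {k : V → ℝ}
    (hk : ∀ i, 0 < k i) :
    limitCoefficient G m k (Sum.elim (fun _ => 1) (fun _ => -m)) = 1 := by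
  have h := limitCoefficient_pos_den hG hm hk
  rw [limitCoefficient_apply]
  have h1 : disturbanceError (Sum.elim (fun _ : V => (1 : ℝ)) (fun _ : V => -m)) =
    fun _ => -m := rfl
  rw [h1, ← Finset.mul_sum, neg_mul, neg_mul, mul_neg, neg_neg, inv_mul_cancel₀ h.ne']

/-- `(1ᵀ x̃)²`. -/
def meanTerm (e : V ⊕ V → ℝ) : ℝ := (∑ i, stateError e i) ^ 2

/-- Minus the derivative of `meanTerm` along the error system. -/
def meanDissipation (m : ℝ) (e : V ⊕ V → ℝ) : ℝ :=
  2 * (∑ i, stateError e i) * (m * (∑ i, stateError e i) + ∑ i, disturbanceError e i)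

theorem isHomogTwo_meanTerm : IsHomogTwo (meanTerm (V := V)) := by
  have h := IsHomogTwo.mul_linear (sumLin ∘ₗ stateError (V := V)) (sumLin ∘ₗ stateError)
  simp only [LinearMap.comp_apply, sumLin_apply, ← sq] at h
  exact h

theorem isHomogTwo_meanDissipation (m : ℝ) : IsHomogTwo (meanDissipation (V := V) m) := by
  have h := (IsHomogTwo.mul_linear (sumLin ∘ₗ stateError (V := V))
    (m • (sumLin ∘ₗ stateError) + sumLin ∘ₗ disturbanceError)).const_mul 2
  simp only [LinearMap.comp_apply, LinearMap.add_apply, LinearMap.smul_apply, sumLin_apply,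
    ← mul_assoc, smul_eq_mul] at h
  exact h

variable [DecidableEq V]

/-- The Laplacian applied to the `x̃` component of the error. -/
def lapStateError : (V ⊕ V → ℝ) →ₗ[ℝ] V → ℝ := (G.lapMatrix ℝ).mulVecLin ∘ₗ stateError

theorem lapStateError_apply (e : V ⊕ V → ℝ) :
    lapStateError G e = G.lapMatrix ℝ *ᵥ stateError e := rfl

theorem errorField_eq (m : ℝ) (k : V → ℝ) (e : V ⊕ V → ℝ) :
    errorField G m k e =
      Sum.elim (-(G.lapMatrix ℝ *ᵥ stateError e) - m • stateError e - disturbanceError e)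
        (fun i => estimatorGain G k i * (G.lapMatrix ℝ *ᵥ stateError e) i) := by
  rw [errorField, errorMatrix, fromBlocks_mulVec]
  congr 1
  · rw [sub_mulVec, neg_mulVec, smul_mulVec, one_mulVec, neg_mulVec, one_mulVec, ← sub_eq_add_neg]
    rfl
  · rw [zero_mulVec, add_zero, ← mulVec_mulVec]
    funext i
    rw [mulVec_diagonal, localProjection_mulVec_apply, estimatorGain, mul_assoc]
    rfl

theorem stateError_errorField (m : ℝ) (k : V → ℝ) (e : V ⊕ V → ℝ) :
    stateError (errorField G m k e) =
      -(G.lapMatrix ℝ *ᵥ stateError e) - m • stateError e - disturbanceError e := by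
  rw [errorField_eq]
  rfl

theorem disturbanceError_errorField (m : ℝ) (k : V → ℝ) (e : V ⊕ V → ℝ) :
    disturbanceError (errorField G m k e) =
      fun i => estimatorGain G k i * (G.lapMatrix ℝ *ᵥ stateError e) i := by
  rw [errorField_eq]
  rfl

theorem isSolution_errorField_of_isClosedLoop {m : ℝ} {k w : V → ℝ} {x xhat what : ℝ → V → ℝ}
    (h : IsClosedLoop G m k w x xhat what) :
    IsSolution (errorField G m k) (fun t => Sum.elim (x t - xhat t) (what t - w)) := by
  intro t ht
  rw [errorField, errorMatrix, fromBlocks_mulVec, hasDerivWithinAt_pi]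
  rintro (i | i)
  · have h1 := (hasDerivWithinAt_pi.1 ((h.state t ht).sub (h.predictor t ht))) i
    refine h1.congr_deriv ?_
    simp [sub_mulVec, neg_mulVec, smul_mulVec, Function.comp_def, mulVec_sub, ← Pi.sub_def]
    ring
  · have h1 := (hasDerivWithinAt_pi.1 ((h.estimator t ht).sub_const w)) i
    refine h1.congr_deriv ?_
    simp [Function.comp_def, ← Pi.sub_def]

theorem limitCoefficient_errorField (m : ℝ) {k : V → ℝ} (hk : ∀ i, 0 < k i) (e : V ⊕ V → ℝ) :
    limitCoefficient G m k (errorField G m k e) = 0 := by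
  rw [limitCoefficient_apply, disturbanceError_errorField]
  have : ∀ i, estimatorGain G k i * (G.lapMatrix ℝ *ᵥ stateError e) i * (estimatorGain G k i)⁻¹ =
      (G.lapMatrix ℝ *ᵥ stateError e) i := fun i => by
    have := (estimatorGain_pos G hk i).ne'
    field_simp
  simp only [this, G.sum_lapMatrix_mulVec, mul_zero]

theorem errorField_equilibrium (m : ℝ) (k : V → ℝ) :
    errorField G m k (Sum.elim (fun _ => 1) (fun _ => -m)) = 0 := by
  have h1 : stateError (Sum.elim (fun _ : V => (1 : ℝ)) (fun _ : V => -m)) = fun _ => 1 := rfl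
  have h2 : disturbanceError (Sum.elim (fun _ : V => (1 : ℝ)) (fun _ : V => -m)) =
    fun _ => -m := rfl
  rw [errorField_eq, h1, h2, G.lapMatrix_mulVec_const_eq_zero]
  ext (i | i) <;> simp

-- Connectedness makes `w̃` constant, and a constant whose sum with positive weights vanishes is
-- zero.
variable {G} in
theorem disturbanceError_eq_zero_of_limitCoefficient (hG : G.Connected) {m : ℝ} (hm : 0 < m)
    {k : V → ℝ} (hk : ∀ i, 0 < k i) {e : V ⊕ V → ℝ} (he : limitCoefficient G m k e = 0)
    (hL : G.lapMatrix ℝ *ᵥ disturbanceError e = 0) : disturbanceError e = 0 := by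
  obtain ⟨c, hc⟩ := hG.exists_eq_const_of_lapMatrix_mulVec_eq_zero hL
  have h := limitCoefficient_pos_den hG hm hk
  rw [limitCoefficient_apply, hc, ← Finset.mul_sum, mul_eq_zero, mul_eq_zero] at he
  rcases he with he | rfl | he
  · exact absurd he (neg_ne_zero.2 (inv_ne_zero h.ne'))
  · exact hc
  · exact absurd he (right_ne_zero_of_mul h.ne')

variable {G} in
theorem sum_stateError_ne_zero (hG : G.Connected) {e : V ⊕ V → ℝ} (he : e ≠ 0)
    (hw : disturbanceError e = 0) (hL : G.lapMatrix ℝ *ᵥ stateError e = 0) :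
    ∑ i, stateError e i ≠ 0 := by
  obtain ⟨c, hc⟩ := hG.exists_eq_const_of_lapMatrix_mulVec_eq_zero hL
  have := hG.nonempty
  intro hs
  rw [hc] at hs
  have hc0 : c = 0 := by simpa using hs
  refine he (funext ?_)
  rintro (i | i)
  · exact (congrFun hc i).trans hc0
  · exact congrFun hw i

/-- `x̃ᵀ L x̃ + w̃ᵀ (K S)⁻¹ w̃`. -/
def energy (k : V → ℝ) (e : V ⊕ V → ℝ) : ℝ :=
  stateError e ⬝ᵥ lapStateError G e +
    disturbanceError e ⬝ᵥ fun i => (estimatorGain G k i)⁻¹ * disturbanceError e i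

/-- Minus the derivative of `energy` along the error system. -/
def energyDissipation (m : ℝ) (e : V ⊕ V → ℝ) : ℝ :=
  2 * (lapStateError G e ⬝ᵥ lapStateError G e + m * (stateError e ⬝ᵥ lapStateError G e))

/-- `2 w̃ᵀ L x̃`. -/
def crossTerm (e : V ⊕ V → ℝ) : ℝ := 2 * (disturbanceError e ⬝ᵥ lapStateError G e)

/-- Minus the derivative of `crossTerm` along the error system. -/
def crossDissipation (m : ℝ) (k : V → ℝ) (e : V ⊕ V → ℝ) : ℝ :=
  2 * (disturbanceError e ⬝ᵥ G.lapMatrix ℝ *ᵥ (lapStateError G e + m • stateError e +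
      disturbanceError e) -
    (fun i => estimatorGain G k i * lapStateError G e i) ⬝ᵥ lapStateError G e)

theorem isHomogTwo_energy (k : V → ℝ) : IsHomogTwo (energy G k) := by
  have h := (IsHomogTwo.dotProduct_linear (V := V) stateError (lapStateError G)).add
    (IsHomogTwo.dotProduct_linear disturbanceError
      (LinearMap.mulLeft ℝ (fun i => (estimatorGain G k i)⁻¹) ∘ₗ disturbanceError))
  simp only [LinearMap.comp_apply, LinearMap.mulLeft_apply, Pi.mul_def] at h
  exact h

theorem isHomogTwo_energyDissipation (m : ℝ) : IsHomogTwo (energyDissipation G m) :=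
  ((IsHomogTwo.dotProduct_linear (lapStateError G) (lapStateError G)).add
    ((IsHomogTwo.dotProduct_linear (stateError (V := V)) (lapStateError G)).const_mul m)).const_mul 2

theorem isHomogTwo_crossTerm : IsHomogTwo (crossTerm G) :=
  (IsHomogTwo.dotProduct_linear (disturbanceError (V := V)) (lapStateError G)).const_mul 2

theorem isHomogTwo_crossDissipation (m : ℝ) (k : V → ℝ) :
    IsHomogTwo (crossDissipation G m k) := by
  have h := ((IsHomogTwo.dotProduct_linear disturbanceError ((G.lapMatrix ℝ).mulVecLin ∘ₗ
      (lapStateError G + m • stateError + disturbanceError))).add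
    (IsHomogTwo.dotProduct_linear (LinearMap.mulLeft ℝ (estimatorGain G k) ∘ₗ lapStateError G)
      (lapStateError G)).neg).const_mul 2
  simp only [LinearMap.comp_apply, LinearMap.mulLeft_apply, Pi.mul_def, ← sub_eq_add_neg] at h
  exact h

variable {m : ℝ} {k : V → ℝ} {e : ℝ → V ⊕ V → ℝ}

/-- The weights `(K S)⁻¹` make the indefinite terms `(L x̃)ᵀ w̃` from the two summands cancel. -/
theorem hasDerivWithinAt_energy (hk : ∀ i, 0 < k i) (he : IsSolution (errorField G m k) e) {t : ℝ}
    (ht : 0 ≤ t) :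
    HasDerivWithinAt (fun t => energy G k (e t)) (-energyDissipation G m (e t))
      (Set.Ici 0) t := by
  have h := (he.hasDerivWithinAt_dotProduct stateError (lapStateError G) ht).add
    (he.hasDerivWithinAt_dotProduct disturbanceError
      (LinearMap.mulLeft ℝ (fun i => (estimatorGain G k i)⁻¹) ∘ₗ disturbanceError) ht)
  simp only [LinearMap.comp_apply, LinearMap.mulLeft_apply, Pi.mul_def] at h
  refine h.congr_deriv ?_
  simp only [energyDissipation, lapStateError_apply, stateError_errorField,
    disturbanceError_errorField, G.dotProduct_lapMatrix_mulVec_comm (stateError (e t))]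
  have h1 : ((fun i => estimatorGain G k i * (G.lapMatrix ℝ *ᵥ stateError (e t)) i) ⬝ᵥ
      fun i => (estimatorGain G k i)⁻¹ * disturbanceError (e t) i) =
      (G.lapMatrix ℝ *ᵥ stateError (e t)) ⬝ᵥ disturbanceError (e t) :=
    Finset.sum_congr rfl fun i _ => by
      have := (estimatorGain_pos G hk i).ne'
      field_simp
  have h2 : (disturbanceError (e t) ⬝ᵥ fun i => (estimatorGain G k i)⁻¹ *
      (estimatorGain G k i * (G.lapMatrix ℝ *ᵥ stateError (e t)) i)) =
      (G.lapMatrix ℝ *ᵥ stateError (e t)) ⬝ᵥ disturbanceError (e t) :=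
    Finset.sum_congr rfl fun i _ => by
      have := (estimatorGain_pos G hk i).ne'
      field_simp
  rw [h1, h2]
  simp only [sub_dotProduct, dotProduct_sub, neg_dotProduct, dotProduct_neg, smul_dotProduct,
    dotProduct_smul, smul_eq_mul,
    dotProduct_comm (disturbanceError (e t)) (G.lapMatrix ℝ *ᵥ stateError (e t)),
    dotProduct_comm (stateError (e t)) (G.lapMatrix ℝ *ᵥ stateError (e t))]
  ring

theorem hasDerivWithinAt_crossTerm (he : IsSolution (errorField G m k) e) {t : ℝ} (ht : 0 ≤ t) :
    HasDerivWithinAt (fun t => crossTerm G (e t)) (-crossDissipation G m k (e t))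
      (Set.Ici 0) t := by
  refine ((he.hasDerivWithinAt_dotProduct disturbanceError (lapStateError G) ht).const_mul
    2).congr_deriv ?_
  simp only [crossDissipation, lapStateError_apply, stateError_errorField,
    disturbanceError_errorField, mulVec_sub, mulVec_add, mulVec_neg, dotProduct_sub,
    dotProduct_add, dotProduct_neg]
  ring

theorem hasDerivWithinAt_meanTerm (he : IsSolution (errorField G m k) e) {t : ℝ} (ht : 0 ≤ t) :
    HasDerivWithinAt (fun t => meanTerm (e t)) (-meanDissipation m (e t)) (Set.Ici 0) t := by
  have h := (he.hasDerivWithinAt_linear (sumLin ∘ₗ stateError) ht).pow 2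
  simp only [LinearMap.comp_apply, sumLin_apply] at h
  refine h.congr_deriv ?_
  simp only [meanDissipation, stateError_errorField, Pi.sub_apply, Pi.neg_apply, Pi.smul_apply,
    smul_eq_mul, Finset.sum_sub_distrib, Finset.sum_neg_distrib, G.sum_lapMatrix_mulVec,
    ← Finset.mul_sum]
  ring

variable {G}

/-- Finsler's lemma on `ker l ∩ {L x̃ = 0}`, where the energy is not dissipated: there the cross
dissipation reduces to `2 w̃ᵀ L w̃ ≥ 0`, and the mean term covers its zeros. -/
theorem exists_crossDissipation_add_meanDissipation_pos (hG : G.Connected) (hm : 0 < m)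
    (hk : ∀ i, 0 < k i) :
    ∃ c > 0, ∀ e, limitCoefficient G m k e = 0 → G.lapMatrix ℝ *ᵥ stateError e = 0 → e ≠ 0 →
      0 < crossDissipation G m k e + c * meanDissipation m e := by
  have hred : ∀ e, G.lapMatrix ℝ *ᵥ stateError e = 0 → crossDissipation G m k e =
      2 * (disturbanceError e ⬝ᵥ G.lapMatrix ℝ *ᵥ disturbanceError e) := by
    intro e he
    simp [crossDissipation, lapStateError_apply, he, mulVec_add, mulVec_smul]
  have hnonneg : ∀ e ∈ LinearMap.ker (limitCoefficient G m k) ⊓ LinearMap.ker (lapStateError G),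
      0 ≤ crossDissipation G m k e := fun e he => by
    rw [hred e he.2]
    exact mul_nonneg two_pos.le (G.lapMatrix_dotProduct_nonneg _)
  have hpos : ∀ e ∈ LinearMap.ker (limitCoefficient G m k) ⊓ LinearMap.ker (lapStateError G),
      e ≠ 0 → crossDissipation G m k e = 0 → 0 < meanDissipation m e := fun e he he0 h0 => by
    rw [hred e he.2, mul_eq_zero, or_iff_right two_ne_zero,
      G.lapMatrix_dotProduct_eq_zero_iff] at h0
    have hw := disturbanceError_eq_zero_of_limitCoefficient hG hm hk he.1 h0
    have hs := sum_stateError_ne_zero hG he0 hw he.2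
    have : meanDissipation m e = 2 * m * (∑ i, stateError e i) ^ 2 := by
      simp only [meanDissipation, hw, Pi.zero_apply, Finset.sum_const_zero]
      ring
    rw [this]
    positivity
  obtain ⟨c, hc, h⟩ := (isHomogTwo_crossDissipation G m k).exists_add_mul_pos
    (isHomogTwo_meanDissipation m) _ hnonneg hpos
  exact ⟨c, hc, fun e h1 h2 h3 => h e ⟨h1, h2⟩ h3⟩

/-- The error system has a strict quadratic Lyapunov function on the invariant subspace
`limitCoefficient = 0`. -/
theorem exists_strict_lyapunov (hG : G.Connected) (hm : 0 < m) (hk : ∀ i, 0 < k i) :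
    ∃ W D : (V ⊕ V → ℝ) → ℝ, IsHomogTwo W ∧ IsHomogTwo D ∧
      (∀ e, limitCoefficient G m k e = 0 → e ≠ 0 → 0 < W e) ∧
      (∀ e, limitCoefficient G m k e = 0 → e ≠ 0 → 0 < D e) ∧
      ∀ e : ℝ → V ⊕ V → ℝ, IsSolution (errorField G m k) e → ∀ t, 0 ≤ t →
        HasDerivWithinAt (fun t => W (e t)) (-D (e t)) (Set.Ici 0) t := by
  obtain ⟨c, hc, hcpos⟩ := exists_crossDissipation_add_meanDissipation_pos hG hm hk
  have hW2 := (isHomogTwo_crossTerm G).add ((isHomogTwo_meanTerm (V := V)).const_mul c)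
  have hD2 := (isHomogTwo_crossDissipation G m k).add
    ((isHomogTwo_meanDissipation (V := V) m).const_mul c)
  have hLx := fun e : V ⊕ V → ℝ => G.lapMatrix_dotProduct_nonneg (stateError e)
  have hLL : ∀ e, 0 ≤ lapStateError G e ⬝ᵥ lapStateError G e := fun e =>
    Finset.sum_nonneg fun i _ => mul_self_nonneg _
  have hw0 : ∀ e : V ⊕ V → ℝ, ∀ i ∈ Finset.univ, 0 ≤
      disturbanceError e i * ((estimatorGain G k i)⁻¹ * disturbanceError e i) := fun e i _ => by
    rw [mul_left_comm]
    exact mul_nonneg (inv_pos.2 (estimatorGain_pos G hk i)).le (mul_self_nonneg _)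
  have hD := (isHomogTwo_energyDissipation G m).eventually_add_mul_pos hD2
    (LinearMap.ker (limitCoefficient G m k))
    (fun e _ => mul_nonneg two_pos.le (add_nonneg (hLL e) (mul_nonneg hm.le (hLx e))))
    (fun e he he0 h0 => by
      have h0 : 2 * (lapStateError G e ⬝ᵥ lapStateError G e +
        m * (stateError e ⬝ᵥ G.lapMatrix ℝ *ᵥ stateError e)) = 0 := h0
      have h1 := hLL e
      have h2 := mul_nonneg hm.le (hLx e)
      have h3 : lapStateError G e ⬝ᵥ lapStateError G e = 0 := by linarith
      exact hcpos e he (dotProduct_self_eq_zero.1 h3) he0)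
  -- The energy is only semidefinite: it vanishes when `w̃ = 0` and `x̃` is constant. There
  -- `crossTerm` is zero and `meanTerm` is positive.
  have hW := (isHomogTwo_energy G k).eventually_add_mul_pos hW2
    (LinearMap.ker (limitCoefficient G m k))
    (fun e _ => add_nonneg (hLx e) (Finset.sum_nonneg (hw0 e)))
    (fun e _ he0 h0 => by
      have h0 : stateError e ⬝ᵥ G.lapMatrix ℝ *ᵥ stateError e + ∑ i,
        disturbanceError e i * ((estimatorGain G k i)⁻¹ * disturbanceError e i) = 0 := h0
      have h1 := hLx e
      have h3 := Finset.sum_nonneg (hw0 e)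
      have hL := (G.lapMatrix_dotProduct_eq_zero_iff _).1 (by linarith)
      have hw : disturbanceError e = 0 := funext fun i => by
        have h4 := (Finset.sum_eq_zero_iff_of_nonneg (hw0 e)).1 (by linarith) i
          (Finset.mem_univ i)
        simpa [(estimatorGain_pos G hk i).ne'] using h4
      have hs := sum_stateError_ne_zero hG he0 hw hL
      have hx : crossTerm G e = 0 := by simp [crossTerm, hw]
      rw [hx, zero_add, meanTerm]
      positivity)
  -- Both positivity claims hold for all small `γ > 0`, so one `γ` serves both.
  obtain ⟨γ, hDγ, hWγ⟩ := (hD.and hW).exists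
  refine ⟨_, _, (isHomogTwo_energy G k).add (hW2.const_mul γ),
    (isHomogTwo_energyDissipation G m).add (hD2.const_mul γ), hWγ, hDγ, fun e he t ht => ?_⟩
  exact ((hasDerivWithinAt_energy G hk he ht).add (((hasDerivWithinAt_crossTerm G he ht).add
    ((hasDerivWithinAt_meanTerm G he ht).const_mul c)).const_mul γ)).congr_deriv (by ring)

end ErrorSystem

end

theorem theorem1 {V : Type*} [Fintype V] [DecidableEq V] (G : SimpleGraph V) [DecidableRel G.Adj]
    (hG : G.Connected) (m : ℝ) (hm : 0 < m) (k : V → ℝ) (hk : ∀ i, 0 < k i) :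
    -- the errors `x̃ = x - x̂`, `w̃ = ŵ - w` of the controlled system obey the error system
    (∀ (w : V → ℝ) (x xhat what : ℝ → V → ℝ), IsClosedLoop G m k w x xhat what →
      IsSolution (errorField G m k) (fun t => Sum.elim (x t - xhat t) (what t - w))) ∧
    -- the error system has a solution for every initial condition
    (∀ e₀ : V ⊕ V → ℝ, ∃ e : ℝ → V ⊕ V → ℝ, IsSolution (errorField G m k) e ∧ e 0 = e₀) ∧
    -- every solution is Lyapunov stable and converges to a multiple of `[1; -m 1]`
    (∀ e : ℝ → V ⊕ V → ℝ, IsSolution (errorField G m k) e →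
      IsLyapunovStable (errorField G m k) e ∧
      ∃ ε : ℝ, Tendsto e atTop
        (𝓝 (ε • Sum.elim (fun _ : V => (1 : ℝ)) (fun _ : V => -m)))) := by
  obtain ⟨W, D, hW, hD, hWpos, hDpos, hderiv⟩ := exists_strict_lyapunov hG hm hk
  obtain ⟨C, hC, r, hr, hdecay⟩ := hW.exists_exp_decay hD
    (LinearMap.ker (limitCoefficient G m k)) hWpos hDpos
  refine ⟨fun w x xhat what h => isSolution_errorField_of_isClosedLoop G h,
    exists_isSolution_linear (errorMatrix G m k).mulVecLin, fun e he => ?_⟩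
  have h := lyapunovStable_and_tendsto_of_exp_decay (errorMatrix G m k).mulVecLin
    (Sum.elim (fun _ : V => (1 : ℝ)) (fun _ : V => -m)) (limitCoefficient G m k)
    (errorField_equilibrium G m k) (limitCoefficient_equilibrium hG hm hk)
    (limitCoefficient_errorField G m hk) hC hr
    (fun y hy hy0 => hdecay y hy0 (hderiv y hy)) he
  exact ⟨h.1, _, h.2⟩
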